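/- Let $K$ be a field, let $n \ge 0$, and let $G$ be a finite simple graph (not necessarily connected) with vertex set $[n]=\{1,\dots,n\}$. Let $S = K[x_1,\dots,x_n,y_1,\dots,y_n]$ and let $J_G \subseteq S$ be the binomial edge ideal of $G$, i.e. the ideal generated by the binomials $x_iy_j - x_jy_i$ with $i<j$ and $\{i,j\}\in E(G)$. Let $<$ be the lexicographic order on $S$ induced by $x_1>\cdots>x_n>y_1>\cdots>y_n$, and let $\mathrm{in}_<(J_G)$ be the initial ideal of $J_G$, generated by the leading terms of the nonzero elements of $J_G$. For $T\subseteq [n]$ let $c(T)$ denote the number of connected components of the induced subgraph $G\setminus T$ on $[n]\setminus T$. Call $T$ a cutset of $G$ if $c(T\setminus\{t\})<c(T)$ for every $t\in T$ (in particular, $\emptyset$ is a cutset). For a cutset $T$, let $G_1,\dots,G_{c(T)}$ be the connected components of $G\setminus T$, and for $\mathbf v=(v_1,\dots,v_{c(T)})\in V(G_1)\times\cdots\times V(G_{c(T)})$ put \[ F(T,\mathbf v)=\bigcup_{k=1}^{c(T)}\Bigl(\{y_j : j\in V(G_k),\ j\le v_k\}\cup\{x_j : j\in V(G_k),\ j\ge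 v_k\}\Bigr). \] A simplicial complex on the set of variables $\{x_1,\dots,x_n,y_1,\dots,y_n\}$ is a collection of subsets (faces) closed under taking subsets; its facets are its inclusion-maximal faces, and its Stanley–Reisner ideal $I_\Delta\subseteq S$ is generated by the squarefree monomials $\prod_{z\in F}z$ with $F\notin\Delta$. Then there is a unique simplicial complex $\Delta_<$ on $\{x_1,\dots,x_n,y_1,\dots,y_n\}$ such that $\mathrm{in}_<(J_G)=I_{\Delta_<}$, and its set of facets is \[ \mathcal F(\Delta_<)=\{F(T,\mathbf v) : T \text{ a cutset of } G,\ \mathbf v\in V(G_1)\times\cdots\times V(G_{c(T)})\}. \] -/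

import Mathlib

open MvPolynomial

noncomputable section

/-! ### Simplicial complexes and Stanley–Reisner ideals -/

/-- A simplicial complex on a finite vertex set `σ`: a collection of subsets of `σ` closed under
taking subsets. The empty set is allowed as a face, and singletons need not be faces. -/
structure SimplicialCx (σ : Type*) where
  faces : Set (Finset σ)
  down_closed : ∀ ⦃F F' : Finset σ⦄, F ∈ faces → F' ⊆ F → F' ∈ faces

/-- The facets: the faces that are maximal with respect to inclusion. -/
def SimplicialCx.facets {σ : Type*} (Δ : SimplicialCx σ) : Set (Finset σ) :=
  {F | Maximal (fun F' => F' ∈ Δ.faces) F}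

/-- The Stanley–Reisner ideal: generated by the squarefree monomials `∏ i ∈ F, z i` with `F` not a
face of `Δ`. -/
def stanleyReisnerIdeal (K : Type*) [Field K] {σ : Type*} (Δ : SimplicialCx σ) :
    Ideal (MvPolynomial σ K) :=
  Ideal.span {p | ∃ F : Finset σ, F ∉ Δ.faces ∧ p = ∏ i ∈ F, X i}

/-! ### Initial ideals -/

/-- The initial ideal of `I`: generated by the leading terms of the elements of `I`. -/
def initialIdeal {K : Type*} [Field K] {σ : Type*} (m : MonomialOrder σ)
    (I : Ideal (MvPolynomial σ K)) : Ideal (MvPolynomial σ K) :=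
  Ideal.span {p | ∃ f ∈ I, f ≠ 0 ∧ p = m.leadingTerm f}

/-! ### Binomial edge ideals -/

/-- The `2n` variables `x₁, …, xₙ, y₁, …, yₙ`, linearly ordered as listed. In Mathlib's order
`MonomialOrder.lex` the variable with the smaller index is the larger one, so that on this index
type it is the lexicographic order induced by `x₁ > ⋯ > xₙ > y₁ > ⋯ > yₙ`. -/
abbrev BEVar (n : ℕ) : Type := Fin n ⊕ₗ Fin n

/-- The index of the variable `xᵢ`. -/
def xVar {n : ℕ} (i : Fin n) : BEVar n := toLex (Sum.inl i)

/-- The index of the variable `yᵢ`. -/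
def yVar {n : ℕ} (i : Fin n) : BEVar n := toLex (Sum.inr i)

/-- The binomial edge ideal of `G`, generated by `xᵢ yⱼ - xⱼ yᵢ` for the edges `{i, j}`, `i < j`. -/
def binomialEdgeIdeal (K : Type*) [Field K] {n : ℕ} (G : SimpleGraph (Fin n)) :
    Ideal (MvPolynomial (BEVar n) K) :=
  Ideal.span {f | ∃ i j : Fin n, i < j ∧ G.Adj i j ∧
    f = X (xVar i) * X (yVar j) - X (xVar j) * X (yVar i)}

/-! ### Cutsets and the sets `F(T, v)` -/

/-- The graph `G ∖ T`: the induced subgraph on the vertices outside `T`. -/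
abbrev removeVerts {n : ℕ} (G : SimpleGraph (Fin n)) (T : Finset (Fin n)) :
    SimpleGraph {u : Fin n // u ∉ T} :=
  G.induce {u | u ∉ T}

/-- The number of connected components of `G ∖ T`. -/
def numComponents {n : ℕ} (G : SimpleGraph (Fin n)) (T : Finset (Fin n)) : ℕ :=
  Nat.card (removeVerts G T).ConnectedComponent

/-- `T` is a cutset of `G` if putting back any single vertex of `T` lowers the number of connected
components. The empty set is a cutset. -/
def IsCutset {n : ℕ} (G : SimpleGraph (Fin n)) (T : Finset (Fin n)) : Prop :=
  ∀ v ∈ T, numComponents G (T.erase v) < numComponents G T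

/-- A choice of one vertex in each connected component of `G ∖ T`. -/
abbrev ComponentChoice {n : ℕ} (G : SimpleGraph (Fin n)) (T : Finset (Fin n)) : Type :=
  (C : (removeVerts G T).ConnectedComponent) → C.supp

open Classical in
/-- `F(T, v)`: the union over the connected components `C` of `G ∖ T` of
`{yⱼ : j ∈ C, j ≤ v_C} ∪ {xⱼ : j ∈ C, j ≥ v_C}`. -/
def facetOf {n : ℕ} (G : SimpleGraph (Fin n)) (T : Finset (Fin n)) (v : ComponentChoice G T) :
    Finset (BEVar n) :=
  Finset.univ.filter fun z => ∃ C : (removeVerts G T).ConnectedComponent, ∃ j ∈ C.supp,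
    (z = yVar j.1 ∧ j ≤ (v C).1) ∨ (z = xVar j.1 ∧ (v C).1 ≤ j)

theorem mem_facetOf {n : ℕ} (G : SimpleGraph (Fin n)) (T : Finset (Fin n))
    (v : ComponentChoice G T) (z : BEVar n) :
    z ∈ facetOf G T v ↔ ∃ C : (removeVerts G T).ConnectedComponent, ∃ j ∈ C.supp,
      (z = yVar j.1 ∧ j ≤ (v C).1) ∨ (z = xVar j.1 ∧ (v C).1 ≤ j) := by
  classical
  unfold facetOf
  rw [Finset.mem_filter]
  simp

end

/-!
Let `Δ` be the complex of all subsets of the sets `F(T, v)`, where `T` is any set of vertices. The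
proof shows that `in(J_G) = I_Δ`, that the maximal sets `F(T, v)` are those with `T` a cutset, and
that a complex is determined by its Stanley–Reisner ideal.

*`in(J_G) ⊆ I_Δ`.* For every `T`, the ideal `J_G` lies in the kernel of the monomial map
`xᵢ ↦ aᵢ s_C`, `yᵢ ↦ aᵢ` for `i` in the component `C` of `G ∖ T`, and `xᵢ, yᵢ ↦ 0` for `i ∈ T`
(`param`). A monomial supported on `F(T, v)` has a nonzero image, and it is the smallest monomial of
its fibre (`eq_of_le_of_sum_paramExponent_eq`), so it cannot lead an element of the kernel. Hence
the support of a leading monomial of `J_G` is not a face (`support_degree_not_subset_facetOf`).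

*`I_Δ ⊆ in(J_G)`.* If `F` is not a face, then there are `i < j` with `xᵢ, yⱼ ∈ F` and a path from
`i` to `j` along which every vertex has a variable in `F` (`exists_path_of_notMem_faces`).
Multiplying `xᵢ yⱼ - xⱼ yᵢ` by one variable of each interior vertex of the path gives an element of
`J_G` (`prod_X_mul_edgeBinomial_mem`), so `∏ F` is the leading term of an element of `J_G`. No
Gröbner basis of `J_G` is needed.

*Facets.* Putting `t ∈ T` back lowers the number of components exactly when it merges two components
of `G ∖ T` (`numComponents_erase_lt_iff`). If it merges none, all choices `v` can be kept and
`F(T, v)` grows (`exists_facetOf_ssubset`). If `F(T, v) ⊆ F(T', v')`, then `T' ⊆ T` and `v'` makes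
in each component of `G ∖ T'` the choice made by `v` in all the components of `G ∖ T` inside it, so
that when `T` is a cutset no two components are merged and `T' = T`, `v' = v`
(`facetOf_eq_of_subset`).
-/

/-! ### Variables -/

theorem xVar_lt_xVar {n : ℕ} {i j : Fin n} : xVar i < xVar j ↔ i < j :=
  Sum.Lex.inl_lt_inl_iff

theorem xVar_lt_yVar {n : ℕ} (i j : Fin n) : xVar i < yVar j :=
  Sum.Lex.inl_lt_inr i j

theorem xVar_injective {n : ℕ} : Function.Injective (xVar (n := n)) := fun _ _ h =>
  Sum.inl_injective (toLex.injective h)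

theorem yVar_injective {n : ℕ} : Function.Injective (yVar (n := n)) := fun _ _ h =>
  Sum.inr_injective (toLex.injective h)

theorem xVar_ne_yVar {n : ℕ} (i j : Fin n) : xVar i ≠ yVar j := (xVar_lt_yVar i j).ne

theorem BEVar.cases {n : ℕ} {P : BEVar n → Prop} (hx : ∀ i, P (xVar i)) (hy : ∀ i, P (yVar i))
    (z : BEVar n) : P z :=
  match z with
  | Sum.inl i => hx i
  | Sum.inr i => hy i

/-! ### Squarefree monomials and Stanley–Reisner ideals -/

theorem prod_X_eq_monomial {K : Type*} [Field K] {σ : Type*} (F : Finset σ) :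
    (∏ i ∈ F, X i : MvPolynomial σ K) = monomial (∑ i ∈ F, Finsupp.single i 1) 1 := by
  rw [monomial_sum_one]
  rfl

theorem sum_single_apply {σ : Type*} [DecidableEq σ] (F : Finset σ) (a : σ) :
    (∑ i ∈ F, Finsupp.single i 1 : σ →₀ ℕ) a = if a ∈ F then 1 else 0 := by
  rw [Finsupp.finsetSum_apply]
  simp [Finsupp.single_apply]

theorem sum_single_le_iff {σ : Type*} (F : Finset σ) (d : σ →₀ ℕ) :
    (∑ i ∈ F, Finsupp.single i 1 : σ →₀ ℕ) ≤ d ↔ F ⊆ d.support := by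
  classical
  constructor
  · intro h a ha
    have := h a
    rw [sum_single_apply, if_pos ha] at this
    rw [Finsupp.mem_support_iff]
    omega
  · intro h a
    rw [sum_single_apply]
    split_ifs with ha
    · exact Nat.one_le_iff_ne_zero.mpr (Finsupp.mem_support_iff.mp (h ha))
    · exact Nat.zero_le _

theorem prod_X_mem_stanleyReisnerIdeal {K : Type*} [Field K] {σ : Type*} (Δ : SimplicialCx σ)
    (F : Finset σ) : (∏ i ∈ F, X i : MvPolynomial σ K) ∈ stanleyReisnerIdeal K Δ ↔ F ∉ Δ.faces := by
  classical
  refine ⟨fun h hF => ?_, fun h => Ideal.subset_span ⟨F, h, rfl⟩⟩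
  have hset : {p : MvPolynomial σ K | ∃ F : Finset σ, F ∉ Δ.faces ∧ p = ∏ i ∈ F, X i} =
      (fun s => monomial s (1 : K)) ''
        {s | ∃ F : Finset σ, F ∉ Δ.faces ∧ s = ∑ i ∈ F, Finsupp.single i 1} := by
    ext p
    simp only [prod_X_eq_monomial, Set.mem_ofPred_eq, Set.mem_image]
    constructor
    · rintro ⟨F, hF, rfl⟩
      exact ⟨_, ⟨F, hF, rfl⟩, rfl⟩
    · rintro ⟨_, ⟨F, hF, rfl⟩, rfl⟩
      exact ⟨F, hF, rfl⟩
  rw [stanleyReisnerIdeal, hset, mem_ideal_span_monomial_image, prod_X_eq_monomial] at h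
  obtain ⟨_, ⟨F', hF', rfl⟩, hle⟩ := h (∑ i ∈ F, Finsupp.single i 1) (by
    rw [mem_support_iff, coeff_monomial, if_pos rfl]
    exact one_ne_zero)
  refine hF' (Δ.down_closed hF fun a ha => ?_)
  have := (sum_single_le_iff _ _).mp hle ha
  rw [Finsupp.mem_support_iff, sum_single_apply] at this
  by_contra hc
  exact this (if_neg hc)

theorem stanleyReisnerIdeal_injective (K : Type*) [Field K] {σ : Type*} :
    Function.Injective (stanleyReisnerIdeal K (σ := σ)) := by
  intro Δ Δ' h
  have hf : Δ.faces = Δ'.faces := by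
    ext F
    rw [← not_iff_not, ← prod_X_mem_stanleyReisnerIdeal (K := K), h,
      prod_X_mem_stanleyReisnerIdeal]
  cases Δ
  cases Δ'
  cases hf
  rfl

theorem monomial_mem_stanleyReisnerIdeal {K : Type*} [Field K] {σ : Type*} (Δ : SimplicialCx σ)
    {d : σ →₀ ℕ} (hd : d.support ∉ Δ.faces) (c : K) :
    monomial d c ∈ stanleyReisnerIdeal K Δ := by
  have hle := (sum_single_le_iff d.support d).mpr subset_rfl
  have : monomial d c = monomial (d - ∑ i ∈ d.support, Finsupp.single i 1) c *
      ∏ i ∈ d.support, X i := by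
    rw [prod_X_eq_monomial, monomial_mul, mul_one, tsub_add_cancel_of_le hle]
  rw [this]
  exact Ideal.mul_mem_left _ _ ((prod_X_mem_stanleyReisnerIdeal Δ _).mpr hd)

/-! ### The sets `F(T, v)` and the components of `G ∖ T` -/

section Facets

variable {n : ℕ} {G : SimpleGraph (Fin n)} {T T' : Finset (Fin n)}

theorem xVar_mem_facetOf {v : ComponentChoice G T} {i : Fin n} :
    xVar i ∈ facetOf G T v ↔
      ∃ h : i ∉ T, (v ((removeVerts G T).connectedComponentMk ⟨i, h⟩)).1.1 ≤ i := by
  rw [mem_facetOf]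
  constructor
  · rintro ⟨C, j, hj, ⟨h, -⟩ | ⟨h, hle⟩⟩
    · exact absurd h (xVar_ne_yVar _ _)
    · obtain rfl := xVar_injective h
      obtain rfl : (removeVerts G T).connectedComponentMk j = C := hj
      exact ⟨j.2, hle⟩
  · rintro ⟨h, hle⟩
    exact ⟨_, ⟨i, h⟩, rfl, Or.inr ⟨rfl, hle⟩⟩

theorem yVar_mem_facetOf {v : ComponentChoice G T} {i : Fin n} :
    yVar i ∈ facetOf G T v ↔
      ∃ h : i ∉ T, i ≤ (v ((removeVerts G T).connectedComponentMk ⟨i, h⟩)).1.1 := by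
  rw [mem_facetOf]
  constructor
  · rintro ⟨C, j, hj, ⟨h, hle⟩ | ⟨h, -⟩⟩
    · obtain rfl := yVar_injective h
      obtain rfl : (removeVerts G T).connectedComponentMk j = C := hj
      exact ⟨j.2, hle⟩
    · exact absurd h.symm (xVar_ne_yVar _ _)
  · rintro ⟨h, hle⟩
    exact ⟨_, ⟨i, h⟩, rfl, Or.inl ⟨rfl, hle⟩⟩

/-- The set `T` is recovered from `F(T, v)` as the set of vertices having no variable in it. -/
theorem exists_mem_facetOf_iff {v : ComponentChoice G T} {i : Fin n} :
    (xVar i ∈ facetOf G T v ∨ yVar i ∈ facetOf G T v) ↔ i ∉ T := by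
  rw [xVar_mem_facetOf, yVar_mem_facetOf]
  constructor
  · rintro (⟨h, -⟩ | ⟨h, -⟩) <;> exact h
  · intro h
    rcases le_total (v ((removeVerts G T).connectedComponentMk ⟨i, h⟩)).1.1 i with h' | h'
    · exact Or.inl ⟨h, h'⟩
    · exact Or.inr ⟨h, h'⟩

theorem connectedComponentMk_choice (v : ComponentChoice G T)
    (C : (removeVerts G T).ConnectedComponent) :
    (removeVerts G T).connectedComponentMk (v C).1 = C := (v C).2

/-- The chosen vertices are exactly those for which both variables lie in `F(T, v)`. -/
theorem xVar_yVar_mem_facetOf {v : ComponentChoice G T} {i : Fin n} :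
    (xVar i ∈ facetOf G T v ∧ yVar i ∈ facetOf G T v) ↔
      ∃ h : i ∉ T, (v ((removeVerts G T).connectedComponentMk ⟨i, h⟩)).1.1 = i := by
  rw [xVar_mem_facetOf, yVar_mem_facetOf]
  constructor
  · rintro ⟨⟨h, h1⟩, _, h2⟩
    exact ⟨h, le_antisymm h1 h2⟩
  · rintro ⟨h, h1⟩
    exact ⟨⟨h, h1.le⟩, h, h1.ge⟩

/-- For `T' ⊆ T`, the map sending a component of `G ∖ T` to the component of `G ∖ T'`
containing it. -/
def componentMap (G : SimpleGraph (Fin n)) (h : T' ⊆ T) :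
    (removeVerts G T).ConnectedComponent → (removeVerts G T').ConnectedComponent :=
  SimpleGraph.ConnectedComponent.map
    (⟨fun u => ⟨u.1, fun hu => u.2 (h hu)⟩, fun hab => hab⟩ : removeVerts G T →g removeVerts G T')

theorem componentMap_mk (h : T' ⊆ T) (u : {u : Fin n // u ∉ T}) :
    componentMap G h ((removeVerts G T).connectedComponentMk u) =
      (removeVerts G T').connectedComponentMk ⟨u.1, fun hu => u.2 (h hu)⟩ := rfl

theorem componentMap_comp {T'' : Finset (Fin n)} (h : T' ⊆ T) (h' : T'' ⊆ T')
    (C : (removeVerts G T).ConnectedComponent) :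
    componentMap G h' (componentMap G h C) = componentMap G (h'.trans h) C := by
  induction C using SimpleGraph.ConnectedComponent.ind
  rfl

/-- If `t` has no neighbour outside `T`, then putting `t` back merges no two components. -/
theorem componentMap_erase_injective_of_isolated {t : Fin n}
    (hn : ∀ u, u ∉ T → ¬ G.Adj t u) :
    Function.Injective (componentMap G (T.erase_subset t)) := by
  classical
  -- The component in `G ∖ T`, with a default value at `t`, is constant along edges of the graph
  -- in which `t` has been put back.
  let g : {u : Fin n // u ∉ T.erase t} → Option (removeVerts G T).ConnectedComponent := fun u =>
    if h : u.1 ∉ T then some ((removeVerts G T).connectedComponentMk ⟨u.1, h⟩) else none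
  have hmem : ∀ u : {u : Fin n // u ∉ T.erase t}, u.1 ∈ T → u.1 = t := fun u hu => by
    by_contra hne
    exact u.2 (Finset.mem_erase.mpr ⟨hne, hu⟩)
  have hadj : ∀ a b, (removeVerts G (T.erase t)).Adj a b → g a = g b := by
    intro a b hab
    have hab' : G.Adj a.1 b.1 := hab
    by_cases ha : a.1 ∈ T
    · have hat := hmem a ha
      by_cases hb : b.1 ∈ T
      · exact absurd (hat.trans (hmem b hb).symm) hab'.ne
      · rw [hat] at hab'
        exact absurd hab' (hn _ hb)
    · by_cases hb : b.1 ∈ T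
      · rw [hmem b hb] at hab'
        exact absurd hab'.symm (hn _ ha)
      · simp only [g, dif_pos ha, dif_pos hb]
        congr 1
        exact SimpleGraph.ConnectedComponent.sound
          (SimpleGraph.Adj.reachable (G := removeVerts G T) (u := ⟨a.1, ha⟩) (v := ⟨b.1, hb⟩) hab')
  have hreach : ∀ a b, (removeVerts G (T.erase t)).Reachable a b → g a = g b := by
    rintro a b ⟨p⟩
    induction p with
    | nil => rfl
    | cons h _ ih => exact (hadj _ _ h).trans ih
  intro C D
  induction C using SimpleGraph.ConnectedComponent.ind with | _ a
  induction D using SimpleGraph.ConnectedComponent.ind with | _ b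
  intro h
  have := hreach _ _ (SimpleGraph.ConnectedComponent.exact h)
  exact Option.some_injective _ ((dif_pos a.2).symm.trans (this.trans (dif_pos b.2)))

theorem componentMap_erase_surjective_of_adj {t u : Fin n} (hu : u ∉ T) (htu : G.Adj t u) :
    Function.Surjective (componentMap G (T.erase_subset t)) := by
  intro C
  induction C using SimpleGraph.ConnectedComponent.ind with | _ a
  by_cases ha : a.1 ∈ T
  · have hat : a.1 = t := by
      by_contra hne
      exact a.2 (Finset.mem_erase.mpr ⟨hne, ha⟩)
    refine ⟨(removeVerts G T).connectedComponentMk ⟨u, hu⟩, ?_⟩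
    rw [componentMap_mk]
    refine SimpleGraph.ConnectedComponent.sound (SimpleGraph.Adj.reachable ?_)
    change G.Adj u a.1
    rw [hat]
    exact htu.symm
  · exact ⟨(removeVerts G T).connectedComponentMk ⟨a.1, ha⟩, rfl⟩

/-- Putting `t` back lowers the number of components exactly when it merges two of them: if it
merges none, then it may at most add the new component `{t}`. -/
theorem numComponents_erase_lt_iff {t : Fin n} :
    numComponents G (T.erase t) < numComponents G T ↔
      ¬ Function.Injective (componentMap G (T.erase_subset t)) := by
  constructor
  · intro h hinj
    exact absurd (Nat.card_le_card_of_injective _ hinj) (not_le.mpr h)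
  · intro hinj
    have hsurj : Function.Surjective (componentMap G (T.erase_subset t)) := by
      by_contra hs
      exact hinj (componentMap_erase_injective_of_isolated fun u hu htu =>
        hs (componentMap_erase_surjective_of_adj hu htu))
    refine lt_of_le_of_ne (Nat.card_le_card_of_surjective _ hsurj) fun heq => hinj ?_
    exact ((Nat.bijective_iff_surjective_and_card _).mpr ⟨hsurj, heq.symm⟩).1

/-- If `F(T, v) ⊆ F(T', v')`, then `T' ⊆ T` and the vertex chosen in a component of `G ∖ T` is also
the one chosen in the component of `G ∖ T'` containing it. -/
theorem choice_componentMap_of_facetOf_subset {v : ComponentChoice G T} {v' : ComponentChoice G T'}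
    (hsub : facetOf G T v ⊆ facetOf G T' v') :
    ∃ h : T' ⊆ T, ∀ C, (v' (componentMap G h C)).1.1 = (v C).1.1 := by
  have hT : T' ⊆ T := fun i hi => by
    by_contra hc
    exact exists_mem_facetOf_iff.mp
      ((exists_mem_facetOf_iff (v := v)).mpr hc |>.imp (@hsub _) (@hsub _)) hi
  refine ⟨hT, fun C => ?_⟩
  have hC := connectedComponentMk_choice v C
  have hmem := (xVar_yVar_mem_facetOf (v := v) (i := (v C).1.1)).mpr
    ⟨(v C).1.2, congrArg (fun D => (v D).1.1) hC⟩
  obtain ⟨_, h⟩ := xVar_yVar_mem_facetOf.mp ⟨hsub hmem.1, hsub hmem.2⟩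
  conv_lhs => rw [← hC]
  exact h

/-- A set `F(T, v)` with `T` a cutset is contained in no other set `F(T', v')`: a vertex in
`T ∖ T'` would merge two components of `G ∖ T`, and `v'` would have to choose the vertices chosen
by `v` in both. -/
theorem facetOf_eq_of_subset (hcut : IsCutset G T) {v : ComponentChoice G T}
    {v' : ComponentChoice G T'} (hsub : facetOf G T v ⊆ facetOf G T' v') :
    facetOf G T v = facetOf G T' v' := by
  obtain ⟨hT, hv⟩ := choice_componentMap_of_facetOf_subset hsub
  obtain rfl : T' = T := by
    refine hT.antisymm fun t ht => ?_
    by_contra ht'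
    -- Components merged in `G ∖ (T ∖ {t})` are also merged in the larger graph `G ∖ T'`.
    refine numComponents_erase_lt_iff.mp (hcut t ht) fun C D hCD => ?_
    have hsub' : T' ⊆ T.erase t := fun u hu =>
      Finset.mem_erase.mpr ⟨fun h => ht' (h ▸ hu), hT hu⟩
    have hCD' := congrArg (componentMap G hsub') hCD
    rw [componentMap_comp, componentMap_comp] at hCD'
    have hvCD : (v C).1 = (v D).1 := Subtype.ext (by rw [← hv C, ← hv D, hCD'])
    rw [← connectedComponentMk_choice v C, ← connectedComponentMk_choice v D, hvCD]
  congr 1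
  funext C
  refine Subtype.ext (Subtype.ext ((hv C).symm.trans ?_))
  induction C using SimpleGraph.ConnectedComponent.ind
  rfl

/-- If `T` is not a cutset, then `F(T, v)` can be enlarged: put back a vertex `t` merging no two
components, and keep all the choices. -/
theorem exists_facetOf_ssubset (hcut : ¬ IsCutset G T) (v : ComponentChoice G T) :
    ∃ (T' : Finset (Fin n)) (v' : ComponentChoice G T'), facetOf G T v ⊂ facetOf G T' v' := by
  classical
  unfold IsCutset at hcut
  push Not at hcut
  obtain ⟨t, ht, hle⟩ := hcut
  have hinj : Function.Injective (componentMap G (T.erase_subset t)) := by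
    by_contra hc
    exact absurd (numComponents_erase_lt_iff.mpr hc) (not_lt.mpr hle)
  have hchoice : ∀ D : (removeVerts G (T.erase t)).ConnectedComponent, ∃ u : D.supp,
      ∀ C, componentMap G (T.erase_subset t) C = D → u.1.1 = (v C).1.1 := by
    intro D
    by_cases h : ∃ C, componentMap G (T.erase_subset t) C = D
    · obtain ⟨C, rfl⟩ := h
      refine ⟨⟨⟨(v C).1.1, fun hu => (v C).1.2 (T.erase_subset t hu)⟩, ?_⟩, fun C' hC' => ?_⟩
      · have := congrArg (componentMap G (T.erase_subset t)) (connectedComponentMk_choice v C)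
        rwa [componentMap_mk] at this
      · rw [hinj hC']
    · obtain ⟨u, hu⟩ := D.nonempty_supp
      exact ⟨⟨u, hu⟩, fun C hC => absurd ⟨C, hC⟩ h⟩
  choose v' hv' using hchoice
  refine ⟨T.erase t, v', Finset.ssubset_iff_subset_ne.mpr ⟨fun z => ?_, fun heq => ?_⟩⟩
  · induction z using BEVar.cases with
    | hx i =>
      rw [xVar_mem_facetOf, xVar_mem_facetOf]
      rintro ⟨h, hle⟩
      exact ⟨fun hu => h (T.erase_subset t hu), (hv' _ _ (componentMap_mk _ _)).trans_le hle⟩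
    | hy i =>
      rw [yVar_mem_facetOf, yVar_mem_facetOf]
      rintro ⟨h, hle⟩
      exact ⟨fun hu => h (T.erase_subset t hu), hle.trans_eq (hv' _ _ (componentMap_mk _ _)).symm⟩
  · have := (exists_mem_facetOf_iff (v := v')).mpr (Finset.notMem_erase t T)
    rw [← heq, exists_mem_facetOf_iff] at this
    exact this ht

end Facets

/-- The initial complex of `J_G`: its faces are the subsets of the sets `F(T, v)`, for all sets of
vertices `T`, cutsets or not. -/
def initialComplex {n : ℕ} (G : SimpleGraph (Fin n)) : SimplicialCx (BEVar n) where
  faces := {F | ∃ (T : Finset (Fin n)) (v : ComponentChoice G T), F ⊆ facetOf G T v}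
  down_closed := fun _ _ ⟨T, v, h⟩ h' => ⟨T, v, h'.trans h⟩

theorem facets_initialComplex {n : ℕ} (G : SimpleGraph (Fin n)) :
    (initialComplex G).facets = {F | ∃ T : Finset (Fin n), IsCutset G T ∧
        ∃ v : ComponentChoice G T, F = facetOf G T v} := by
  ext F
  constructor
  · rintro ⟨⟨T, v, hF⟩, hmax⟩
    have heq : F = facetOf G T v := hF.antisymm (hmax ⟨T, v, subset_rfl⟩ hF)
    refine ⟨T, ?_, v, heq⟩
    by_contra hcut
    obtain ⟨T', v', hss⟩ := exists_facetOf_ssubset hcut v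
    rw [← heq] at hss
    exact hss.not_subset (hmax ⟨T', v', subset_rfl⟩ hss.subset)
  · rintro ⟨T, hcut, v, rfl⟩
    refine ⟨⟨T, v, subset_rfl⟩, ?_⟩
    rintro F' ⟨T', v', hF'⟩ hsub
    rw [facetOf_eq_of_subset hcut (hsub.trans hF')]
    exact hF'

/-! ### Leading monomials avoid the faces -/

section Parametrization

variable {n : ℕ} {G : SimpleGraph (Fin n)} {T : Finset (Fin n)}

open Classical in
/-- The component of `G ∖ T` containing a vertex, and `none` for the vertices in `T`. -/
noncomputable def componentOf (G : SimpleGraph (Fin n)) (T : Finset (Fin n)) (i : Fin n) :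
    Option (removeVerts G T).ConnectedComponent :=
  if h : i ∉ T then some ((removeVerts G T).connectedComponentMk ⟨i, h⟩) else none

theorem componentOf_of_notMem {i : Fin n} (h : i ∉ T) :
    componentOf G T i = some ((removeVerts G T).connectedComponentMk ⟨i, h⟩) := dif_pos h

theorem componentOf_eq_of_adj {i j : Fin n} (hi : i ∉ T) (hj : j ∉ T) (h : G.Adj i j) :
    componentOf G T i = componentOf G T j := by
  rw [componentOf_of_notMem hi, componentOf_of_notMem hj]
  congr 1
  exact SimpleGraph.ConnectedComponent.sound
    (SimpleGraph.Adj.reachable (G := removeVerts G T) (u := ⟨i, hi⟩) (v := ⟨j, hj⟩) h)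

/-- The exponent of the image of a variable under the parametrization `xᵢ ↦ aᵢ s_C`, `yᵢ ↦ aᵢ`,
where `C` is the component of `i` in `G ∖ T`. -/
noncomputable def paramExponent (G : SimpleGraph (Fin n)) (T : Finset (Fin n)) (z : BEVar n) :
    Fin n ⊕ Option (removeVerts G T).ConnectedComponent →₀ ℕ :=
  Sum.elim
    (fun i => Finsupp.single (Sum.inl i) 1 + Finsupp.single (Sum.inr (componentOf G T i)) 1)
    (fun i => Finsupp.single (Sum.inl i) 1) (ofLex z)

open Classical in
/-- The coefficient of the image of a variable under the parametrization: the variables of the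
vertices in `T` are sent to `0`. -/
noncomputable def paramCoeff (K : Type*) [Field K] (T : Finset (Fin n)) (z : BEVar n) : K :=
  if Sum.elim id id (ofLex z) ∈ T then 0 else 1

/-- The parametrization `xᵢ ↦ aᵢ s_C`, `yᵢ ↦ aᵢ`, where `C` is the component of `i` in `G ∖ T`,
and `xᵢ, yᵢ ↦ 0` for `i ∈ T`. -/
noncomputable def param (K : Type*) [Field K] (G : SimpleGraph (Fin n)) (T : Finset (Fin n)) :
    MvPolynomial (BEVar n) K →ₐ[K]
      MvPolynomial (Fin n ⊕ Option (removeVerts G T).ConnectedComponent) K :=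
  aeval fun z => monomial (paramExponent G T z) (paramCoeff K T z)

theorem paramExponent_xVar (i : Fin n) : paramExponent G T (xVar i) =
    Finsupp.single (Sum.inl i) 1 + Finsupp.single (Sum.inr (componentOf G T i)) 1 := rfl

theorem paramExponent_yVar (i : Fin n) :
    paramExponent G T (yVar i) = Finsupp.single (Sum.inl i) 1 := rfl

open Classical in
theorem paramCoeff_xVar (K : Type*) [Field K] (i : Fin n) :
    paramCoeff K T (xVar i) = if i ∈ T then 0 else 1 := rfl

open Classical in
theorem paramCoeff_yVar (K : Type*) [Field K] (i : Fin n) :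
    paramCoeff K T (yVar i) = if i ∈ T then 0 else 1 := rfl

theorem paramCoeff_of_mem_facetOf {K : Type*} [Field K] {v : ComponentChoice G T} {z : BEVar n}
    (hz : z ∈ facetOf G T v) : paramCoeff K T z = 1 := by
  classical
  induction z using BEVar.cases with
  | hx i => exact if_neg (xVar_mem_facetOf.mp hz).1
  | hy i => exact if_neg (yVar_mem_facetOf.mp hz).1

theorem sum_BEVar {M : Type*} [AddCommMonoid M] (f : BEVar n → M) :
    ∑ z, f z = ∑ i, f (xVar i) + ∑ i, f (yVar i) := by
  rw [← Equiv.sum_comp toLex f, Fintype.sum_sum_type]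
  rfl

theorem sum_paramExponent_inl (e : BEVar n →₀ ℕ) (i : Fin n) :
    (∑ z, e z • paramExponent G T z) (Sum.inl i) = e (xVar i) + e (yVar i) := by
  classical
  rw [Finsupp.finsetSum_apply, sum_BEVar]
  simp [paramExponent_xVar, paramExponent_yVar, Finsupp.single_apply]

open Classical in
theorem sum_paramExponent_inr (e : BEVar n →₀ ℕ)
    (c : Option (removeVerts G T).ConnectedComponent) :
    (∑ z, e z • paramExponent G T z) (Sum.inr c) =
      ∑ i with componentOf G T i = c, e (xVar i) := by
  rw [Finsupp.finsetSum_apply, sum_BEVar]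
  simp [paramExponent_xVar, paramExponent_yVar, Finsupp.single_apply, Finset.sum_filter]

theorem param_X (K : Type*) [Field K] (z : BEVar n) :
    param K G T (X z) = monomial (paramExponent G T z) (paramCoeff K T z) := aeval_X _ _

theorem param_monomial (K : Type*) [Field K] (e : BEVar n →₀ ℕ) (c : K) :
    param K G T (monomial e c) =
      monomial (∑ z, e z • paramExponent G T z) (c * ∏ z, paramCoeff K T z ^ e z) := by
  rw [param, aeval_monomial, Finsupp.prod_fintype _ _ (fun _ => pow_zero _)]
  simp only [monomial_pow]
  rw [← monomial_sum_prod, algebraMap_eq, C_mul_monomial]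

theorem binomialEdgeIdeal_le_ker_param (K : Type*) [Field K] :
    binomialEdgeIdeal K G ≤ RingHom.ker (param K G T) := by
  refine Ideal.span_le.mpr ?_
  rintro _ ⟨i, j, -, hadj, rfl⟩
  change param K G T _ = 0
  rw [map_sub, map_mul, map_mul]
  simp only [param_X, paramExponent_xVar, paramExponent_yVar, paramCoeff_xVar, paramCoeff_yVar,
    monomial_mul]
  by_cases hi : i ∈ T
  · simp [hi]
  by_cases hj : j ∈ T
  · simp [hj]
  rw [componentOf_eq_of_adj hi hj hadj]
  simp only [if_neg hi, if_neg hj]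
  rw [sub_eq_zero]
  congr 2
  ac_rfl

/-- The parametrization separates a monomial supported on `F(T, v)` from all smaller monomials.
In the fibre of a monomial, the total degree in `xᵢ, yᵢ` is fixed for every `i`, and so is the
total degree in the `x`-variables of every component. Within a component, a monomial supported on
`F(T, v)` has all of its `x`-degree as far to the right as possible. -/
theorem eq_of_le_of_sum_paramExponent_eq {v : ComponentChoice G T} {d e : BEVar n →₀ ℕ}
    (hd : d.support ⊆ facetOf G T v) (hle : toLex e ≤ toLex d)
    (h : ∑ z, e z • paramExponent G T z = ∑ z, d z • paramExponent G T z) : e = d := by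
  classical
  have hvertex : ∀ i, e (xVar i) + e (yVar i) = d (xVar i) + d (yVar i) := by
    intro i
    have := DFunLike.congr_fun h (Sum.inl i)
    rwa [sum_paramExponent_inl, sum_paramExponent_inl] at this
  have hcomp : ∀ c, ∑ i with componentOf G T i = c, e (xVar i) =
      ∑ i with componentOf G T i = c, d (xVar i) := by
    intro c
    have := DFunLike.congr_fun h (Sum.inr c)
    rwa [sum_paramExponent_inr, sum_paramExponent_inr] at this
  rcases hle.eq_or_lt with heq | hlt
  · exact toLex.injective heq
  exfalso
  obtain ⟨z, hz, hzlt⟩ := Finsupp.Lex.lt_iff.mp hlt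
  simp only [ofLex_toLex] at hz hzlt
  induction z using BEVar.cases with
  | hy i =>
    have h1 := hz _ (xVar_lt_yVar i i)
    have h2 := hvertex i
    omega
  | hx i =>
    obtain ⟨hi, hvi⟩ := xVar_mem_facetOf.mp
      (hd (Finsupp.mem_support_iff.mpr (Nat.ne_zero_of_lt hzlt)))
    refine (Finset.sum_lt_sum (fun j hj => ?_) ⟨i, ?_, hzlt⟩).ne (hcomp (componentOf G T i))
    · rcases lt_trichotomy j i with hji | rfl | hij
      · exact (hz _ (xVar_lt_xVar.mpr hji)).le
      · exact hzlt.le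
      · -- Beyond the chosen vertex, `d` has no `y`-degree.
        have hy : d (yVar j) = 0 := by
          by_contra hc
          obtain ⟨hjT, hjv⟩ := yVar_mem_facetOf.mp (hd (Finsupp.mem_support_iff.mpr hc))
          have hcj := (Finset.mem_filter.mp hj).2
          rw [componentOf_of_notMem hjT, componentOf_of_notMem hi] at hcj
          rw [Option.some_injective _ hcj] at hjv
          exact absurd (hjv.trans hvi) (not_le.mpr hij)
        have := hvertex j
        omega
    · exact Finset.mem_filter.mpr ⟨Finset.mem_univ _, rfl⟩

/-- No nonzero element of the binomial edge ideal has a leading monomial supported on `F(T, v)`. -/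
theorem support_degree_not_subset_facetOf {K : Type*} [Field K] {f : MvPolynomial (BEVar n) K}
    (hf : f ∈ binomialEdgeIdeal K G) (hf0 : f ≠ 0) (v : ComponentChoice G T) :
    ¬ (MonomialOrder.lex.degree f).support ⊆ facetOf G T v := by
  classical
  intro hsub
  set d := MonomialOrder.lex.degree f with hd
  have hdf : d ∈ f.support := MonomialOrder.degree_mem_support hf0
  have hzero : param K G T f = 0 := binomialEdgeIdeal_le_ker_param K hf
  have hcoeff : coeff (∑ z, d z • paramExponent G T z) (param K G T f) = coeff d f := by
    conv_lhs => rw [f.as_sum]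
    rw [map_sum, coeff_sum, Finset.sum_eq_single d]
    · rw [param_monomial, coeff_monomial, if_pos rfl, Finset.prod_eq_one, mul_one]
      intro z _
      by_cases hz : d z = 0
      · rw [hz, pow_zero]
      · rw [paramCoeff_of_mem_facetOf (hsub (Finsupp.mem_support_iff.mpr hz)), one_pow]
    · intro e he hne
      rw [param_monomial, coeff_monomial, if_neg]
      exact fun heq => hne (eq_of_le_of_sum_paramExponent_eq hsub
        (MonomialOrder.lex_le_iff.mp (MonomialOrder.le_degree he)) heq)
    · exact fun h => absurd hdf h
  rw [hzero, coeff_zero] at hcoeff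
  exact mem_support_iff.mp hdf hcoeff.symm

end Parametrization

theorem initialIdeal_le_stanleyReisnerIdeal (K : Type*) [Field K] {n : ℕ}
    (G : SimpleGraph (Fin n)) :
    initialIdeal MonomialOrder.lex (binomialEdgeIdeal K G) ≤
      stanleyReisnerIdeal K (initialComplex G) := by
  refine Ideal.span_le.mpr ?_
  rintro _ ⟨f, hf, hf0, rfl⟩
  exact monomial_mem_stanleyReisnerIdeal _
    (by
      rintro ⟨_, v, hsub⟩
      exact support_degree_not_subset_facetOf hf hf0 v hsub) _

/-! ### Nonfaces give leading terms -/

section Nonfaces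

variable {K : Type*} [Field K] {n : ℕ} {G : SimpleGraph (Fin n)}

/-- The binomial `xᵢ yⱼ - xⱼ yᵢ`. -/
noncomputable def edgeBinomial (K : Type*) [Field K] {n : ℕ} (i j : Fin n) :
    MvPolynomial (BEVar n) K :=
  X (xVar i) * X (yVar j) - X (xVar j) * X (yVar i)

theorem edgeBinomial_mem {i j : Fin n} (h : G.Adj i j) :
    edgeBinomial K i j ∈ binomialEdgeIdeal K G := by
  rcases h.ne.lt_or_gt with hij | hji
  · exact Ideal.subset_span ⟨i, j, hij, h, rfl⟩
  · have : edgeBinomial K i j = -edgeBinomial K j i := by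
      unfold edgeBinomial
      ring
    rw [this]
    exact neg_mem (Ideal.subset_span ⟨j, i, hji, h.symm, rfl⟩)

/-- Multiplying `xᵢ yⱼ - xⱼ yᵢ` by a variable of each interior vertex of a path from `i` to `j`
gives an element of the binomial edge ideal, by the relations
`zₖ f_{ij} = zᵢ f_{kj} + zⱼ f_{ik}` for `z = x` and `z = y`, where `f_{ij} = xᵢ yⱼ - xⱼ yᵢ`. -/
theorem prod_X_mul_edgeBinomial_mem {i j : Fin n} (p : G.Walk i j) (hp : p.IsPath)
    (hij : i ≠ j) (A : Finset (BEVar n))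
    (hA : ∀ k ∈ p.support, k ≠ i → k ≠ j → xVar k ∈ A ∨ yVar k ∈ A) :
    (∏ z ∈ A, X z) * edgeBinomial K i j ∈ binomialEdgeIdeal K G := by
  classical
  induction p generalizing A with
  | nil => exact absurd rfl hij
  | @cons i k j h p ih =>
    obtain ⟨hp', hi⟩ := (SimpleGraph.Walk.cons_isPath_iff _ _).mp hp
    by_cases hkj : k = j
    · subst hkj
      exact Ideal.mul_mem_left _ _ (edgeBinomial_mem h)
    have hrest : ∀ z, z = xVar k ∨ z = yVar k →
        (∏ z ∈ A.erase z, X z) * edgeBinomial K k j ∈ binomialEdgeIdeal K G := by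
      intro z hz
      refine ih hp' hkj _ fun w hw hwk hwj => ?_
      have hzx : xVar w ≠ z := by
        rintro rfl
        exact hz.elim (fun h => hwk (xVar_injective h)) (xVar_ne_yVar _ _)
      have hzy : yVar w ≠ z := by
        rintro rfl
        exact hz.elim (fun h => xVar_ne_yVar _ _ h.symm) (fun h => hwk (yVar_injective h))
      have hwi : w ≠ i := by
        rintro rfl
        exact hi hw
      exact (hA w (SimpleGraph.Walk.support_cons h p ▸ List.mem_cons_of_mem _ hw) hwi hwj).imp
        (fun h => Finset.mem_erase.mpr ⟨hzx, h⟩) (fun h => Finset.mem_erase.mpr ⟨hzy, h⟩)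
    have hk : k ∈ (SimpleGraph.Walk.cons h p).support := by
      rw [SimpleGraph.Walk.support_cons]
      exact List.mem_cons_of_mem _ p.start_mem_support
    rcases hA k hk h.ne' hkj with hkA | hkA
    · -- `xₖ f_{ij} = xᵢ f_{kj} + xⱼ f_{ik}`
      have : (∏ z ∈ A, X z) * edgeBinomial K i j =
          X (xVar i) * ((∏ z ∈ A.erase (xVar k), X z) * edgeBinomial K k j) +
          X (xVar j) * (∏ z ∈ A.erase (xVar k), X z) * edgeBinomial K i k := by
        rw [← Finset.mul_prod_erase A _ hkA]
        unfold edgeBinomial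
        ring
      rw [this]
      exact add_mem (Ideal.mul_mem_left _ _ (hrest _ (Or.inl rfl)))
        (Ideal.mul_mem_left _ _ (edgeBinomial_mem h))
    · -- `yₖ f_{ij} = yᵢ f_{kj} + yⱼ f_{ik}`
      have : (∏ z ∈ A, X z) * edgeBinomial K i j =
          X (yVar i) * ((∏ z ∈ A.erase (yVar k), X z) * edgeBinomial K k j) +
          X (yVar j) * (∏ z ∈ A.erase (yVar k), X z) * edgeBinomial K i k := by
        rw [← Finset.mul_prod_erase A _ hkA]
        unfold edgeBinomial
        ring
      rw [this]
      exact add_mem (Ideal.mul_mem_left _ _ (hrest _ (Or.inr rfl)))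
        (Ideal.mul_mem_left _ _ (edgeBinomial_mem h))

theorem leadingTerm_edgeBinomial {i j : Fin n} (hij : i < j) :
    MonomialOrder.lex.leadingTerm (edgeBinomial K i j) = X (xVar i) * X (yVar j) := by
  classical
  have hX : ∀ a b : BEVar n, (X a * X b : MvPolynomial (BEVar n) K) =
      monomial (Finsupp.single a 1 + Finsupp.single b 1) 1 := fun a b => by
    rw [X, X, monomial_mul, mul_one]
  have hdeg : ∀ a b : BEVar n, MonomialOrder.lex.degree
      (X a * X b : MvPolynomial (BEVar n) K) = Finsupp.single a 1 + Finsupp.single b 1 :=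
    fun a b => by rw [hX, MonomialOrder.degree_monomial, if_neg one_ne_zero]
  have hlt : MonomialOrder.lex.toSyn (MonomialOrder.lex.degree
      (X (xVar j) * X (yVar i) : MvPolynomial (BEVar n) K)) <
      MonomialOrder.lex.toSyn (MonomialOrder.lex.degree
      (X (xVar i) * X (yVar j) : MvPolynomial (BEVar n) K)) := by
    rw [hdeg, hdeg, MonomialOrder.lex_lt_iff, Finsupp.Lex.lt_iff]
    refine ⟨xVar i, fun z hz => ?_, ?_⟩
    · have h1 : z ≠ xVar j := (hz.trans (xVar_lt_xVar.mpr hij)).ne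
      have h2 : z ≠ yVar i := (hz.trans (xVar_lt_yVar _ _)).ne
      have h3 : z ≠ yVar j := (hz.trans (xVar_lt_yVar _ _)).ne
      simp [h1.symm, h2.symm, h3.symm, hz.ne']
    · have h1 : xVar j ≠ xVar i := (xVar_lt_xVar.mpr hij).ne'
      simp [h1, (xVar_ne_yVar i _).symm]
  rw [MonomialOrder.leadingTerm, edgeBinomial, MonomialOrder.degree_sub_of_lt hlt,
    MonomialOrder.leadingCoeff_sub_of_lt hlt, hdeg, hX, MonomialOrder.leadingCoeff_monomial]

/-- A nonface `F` contains `xᵢ` and `yⱼ` for some `i < j` joined by a path along which `F` contains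
a variable of every vertex. Otherwise, with `T` the set of vertices without a variable in `F`, in
every component of `G ∖ T` all indices of `y`-variables in `F` would be at most all indices of
`x`-variables in `F`, and a vertex separating them could be chosen. -/
theorem exists_path_of_notMem_faces {F : Finset (BEVar n)} (hF : F ∉ (initialComplex G).faces) :
    ∃ (i j : Fin n) (p : G.Walk i j), i < j ∧ xVar i ∈ F ∧ yVar j ∈ F ∧ p.IsPath ∧
      ∀ k ∈ p.support, xVar k ∈ F ∨ yVar k ∈ F := by
  classical
  let T : Finset (Fin n) := Finset.univ.filter fun k => ¬ (xVar k ∈ F ∨ yVar k ∈ F)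
  have hT : ∀ k, k ∉ T ↔ xVar k ∈ F ∨ yVar k ∈ F := fun k => by
    simp only [T, Finset.mem_filter, Finset.mem_univ, true_and, not_not]
  by_contra hno
  have hsep : ∀ a b : {u // u ∉ T}, (removeVerts G T).Reachable a b →
      xVar a.1 ∈ F → yVar b.1 ∈ F → b.1 ≤ a.1 := by
    rintro a b hab ha hb
    by_contra hlt
    obtain ⟨p, hp⟩ := hab.exists_isPath
    let φ : removeVerts G T →g G := ⟨Subtype.val, fun h => h⟩
    refine hno ⟨a.1, b.1, p.map φ, not_le.mp hlt, ha, hb,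
      hp.map Subtype.val_injective, fun k hk => ?_⟩
    rw [SimpleGraph.Walk.support_map, List.mem_map] at hk
    obtain ⟨u, -, rfl⟩ := hk
    exact (hT _).mp u.2
  have hchoice : ∀ C : (removeVerts G T).ConnectedComponent, ∃ u : C.supp,
      ∀ w ∈ C.supp, (xVar w.1 ∈ F → u.1 ≤ w) ∧ (yVar w.1 ∈ F → w ≤ u.1) := by
    intro C
    have hreach : ∀ a ∈ C.supp, ∀ b ∈ C.supp, (removeVerts G T).Reachable a b :=
      fun a ha b hb => SimpleGraph.ConnectedComponent.exact
        (Eq.trans (b := C) ha (Eq.symm hb))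
    -- The least index of an `x`-variable separates; if there is none, the last vertex does.
    by_cases hx : ∃ a ∈ C.supp, xVar a.1 ∈ F
    · obtain ⟨u, ⟨huC, huF⟩, hmin⟩ :=
        Set.exists_min_image {a | a ∈ C.supp ∧ xVar a.1 ∈ F} id (Set.toFinite _) hx
      exact ⟨⟨u, huC⟩, fun w hw => ⟨fun h => hmin w ⟨hw, h⟩,
        fun h => hsep u w (hreach u huC w hw) huF h⟩⟩
    · obtain ⟨u, huC, hmax⟩ :=
        Set.exists_max_image C.supp id (Set.toFinite _) C.nonempty_supp
      exact ⟨⟨u, huC⟩, fun w hw => ⟨fun h => absurd ⟨w, hw, h⟩ hx, fun _ => hmax w hw⟩⟩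
  choose v hv using hchoice
  refine hF ⟨T, v, fun z hz => ?_⟩
  induction z using BEVar.cases with
  | hx i =>
    exact xVar_mem_facetOf.mpr ⟨(hT i).mpr (Or.inl hz), (hv _ ⟨i, _⟩ rfl).1 hz⟩
  | hy i =>
    exact yVar_mem_facetOf.mpr ⟨(hT i).mpr (Or.inr hz), (hv _ ⟨i, _⟩ rfl).2 hz⟩

theorem prod_X_mem_initialIdeal {F : Finset (BEVar n)} (hF : F ∉ (initialComplex G).faces) :
    (∏ z ∈ F, X z) ∈ initialIdeal MonomialOrder.lex (binomialEdgeIdeal K G) := by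
  classical
  obtain ⟨i, j, p, hij, hi, hj, hp, hsupp⟩ := exists_path_of_notMem_faces hF
  have hj' : yVar j ∈ F.erase (xVar i) := Finset.mem_erase.mpr ⟨(xVar_ne_yVar i j).symm, hj⟩
  set A := (F.erase (xVar i)).erase (yVar j) with hA
  have hmem : (∏ z ∈ A, X z) * edgeBinomial K i j ∈ binomialEdgeIdeal K G := by
    refine prod_X_mul_edgeBinomial_mem p hp hij.ne A fun k hk hki hkj => (hsupp k hk).imp ?_ ?_
    · exact fun h => Finset.mem_erase.mpr ⟨xVar_ne_yVar _ _,
        Finset.mem_erase.mpr ⟨fun h => hki (xVar_injective h), h⟩⟩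
    · exact fun h => Finset.mem_erase.mpr ⟨fun h => hkj (yVar_injective h),
        Finset.mem_erase.mpr ⟨(xVar_ne_yVar _ _).symm, h⟩⟩
  have hlt : MonomialOrder.lex.leadingTerm ((∏ z ∈ A, X z) * edgeBinomial K i j) =
      ∏ z ∈ F, X z := by
    rw [MonomialOrder.leadingTerm_mul, leadingTerm_edgeBinomial hij, prod_X_eq_monomial A,
      MonomialOrder.leadingTerm_monomial, ← prod_X_eq_monomial, ← Finset.mul_prod_erase F _ hi,
      ← Finset.mul_prod_erase _ _ hj']
    ring
  refine Ideal.subset_span ⟨_, hmem, fun h0 => ?_, hlt.symm⟩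
  rw [h0, MonomialOrder.leadingTerm_zero] at hlt
  exact Finset.prod_ne_zero_iff.mpr (fun z _ => X_ne_zero z) hlt.symm

end Nonfaces

theorem initialIdeal_binomialEdgeIdeal (K : Type*) [Field K] {n : ℕ} (G : SimpleGraph (Fin n)) :
    initialIdeal MonomialOrder.lex (binomialEdgeIdeal K G) =
      stanleyReisnerIdeal K (initialComplex G) := by
  refine (initialIdeal_le_stanleyReisnerIdeal K G).antisymm (Ideal.span_le.mpr ?_)
  rintro _ ⟨F, hF, rfl⟩
  exact prod_X_mem_initialIdeal hF

theorem mainTheorem4 (K : Type*) [Field K] (n : ℕ) (G : SimpleGraph (Fin n)) :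
    ∃ Δ : SimplicialCx (BEVar n),
      initialIdeal MonomialOrder.lex (binomialEdgeIdeal K G) = stanleyReisnerIdeal K Δ ∧
      (∀ Δ' : SimplicialCx (BEVar n),
        initialIdeal MonomialOrder.lex (binomialEdgeIdeal K G) = stanleyReisnerIdeal K Δ' →
          Δ' = Δ) ∧
      Δ.facets = {F | ∃ T : Finset (Fin n), IsCutset G T ∧
        ∃ v : ComponentChoice G T, F = facetOf G T v} :=
  ⟨initialComplex G, initialIdeal_binomialEdgeIdeal K G,
    fun _ h => stanleyReisnerIdeal_injective K (h.symm.trans (initialIdeal_binomialEdgeIdeal K G)),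
    facets_initialComplex G⟩
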